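/- Let $\mu$ be a Borel probability measure on $\mathbb{R}$ and let $t>1$. For $z$ in the upper half-plane $\mathbb{C}^+=\{z\in\mathbb{C}:\operatorname{Im}z>0\}$ put $$G_\mu(z)=\int_{\mathbb{R}}\frac{d\mu(s)}{z-s},\qquad F_\mu(z)=\frac1{G_\mu(z)},\qquad H_t(z)=tz-(t-1)F_\mu(z),$$ let $\Omega_t=\{z\in\mathbb{C}^+:\operatorname{Im}H_t(z)>0\}$, and let $\overline{\Omega_t}$ be its closure in $\mathbb{C}$. Let $a=\operatorname{Re}F_\mu(i)$, and let $\rho$ be the measure in the Nevanlinna representation of $F_\mu$, that is, a finite positive Borel measure on $\mathbb{R}$ such that $$F_\mu(z)=a+z+\int_{\mathbb{R}}\frac{1+sz}{s-z}\,d\rho(s),\qquad z\in\mathbb{C}^+.$$ Such a measure $\rho$ exists, and what follows holds for every such $\rho$: $F_\mu$ extends continuously to $\overline{\Omega_t}$ and the extension, still denoted $F_\mu$, satisfies $$|F_\mu(z_1)-F_\mu(z_2)|\le\frac{t}{t-1}\,|z_1-z_2|,\qquad z_1,z_2\in\overline{\Omega_t}.$$ Moreover, for every $z\in\overline{\Omega_t}$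 the function $s\mapsto\frac{1+sz}{s-z}$ is defined $\rho$-almost everywhere (that is, $\rho(\{z\})=0$ if $z$ is real) and $\rho$-integrable, and $$F_\mu(z)=a+z+\int_{\mathbb{R}}\frac{1+sz}{s-z}\,d\rho(s),\qquad z\in\overline{\Omega_t}.$$ If $t>2$, then $$\frac{t-2}{t-1}\,|z_1-z_2|\le|F_\mu(z_1)-F_\mu(z_2)|,\qquad z_1,z_2\in\overline{\Omega_t},$$ and, consequently, $F_\mu$ is one-to-one on $\overline{\Omega_t}$. -/

import Mathlib

open MeasureTheory

namespace NevanlinnaExt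

/-- The Cauchy transform `G_μ(z) = ∫ dμ(s) / (z - s)`, used for `Im z > 0`. -/
noncomputable def cauchyTransform (μ : Measure ℝ) (z : ℂ) : ℂ :=
  ∫ s : ℝ, 1 / (z - (s : ℂ)) ∂μ

/-- The reciprocal Cauchy transform `F_μ = 1 / G_μ`, used for `Im z > 0`. -/
noncomputable def recipCauchy (μ : Measure ℝ) (z : ℂ) : ℂ :=
  1 / cauchyTransform μ z

/-- `H_t(z) = t z - (t - 1) F_μ(z)`, used for `Im z > 0`. -/
noncomputable def subordH (μ : Measure ℝ) (t : ℝ) (z : ℂ) : ℂ :=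
  (t : ℂ) * z - ((t : ℂ) - 1) * recipCauchy μ z

/-- `Ω_t = {z ∈ ℂ⁺ : Im H_t(z) > 0}`. -/
def omegaSet (μ : Measure ℝ) (t : ℝ) : Set ℂ :=
  {z : ℂ | 0 < z.im ∧ 0 < (subordH μ t z).im}

/-- The integrand `(1 + s z) / (s - z)` of the Nevanlinna formula. -/
noncomputable def nevKernel (z : ℂ) (s : ℝ) : ℂ :=
  (1 + (s : ℂ) * z) / ((s : ℂ) - z)

/-- The right-hand side `a + z + ∫ (1 + s z) / (s - z) dρ(s)` of the Nevanlinna formula,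
with `a = Re F_μ(i)`. -/
noncomputable def nevFormula (μ ρ : Measure ℝ) (z : ℂ) : ℂ :=
  ((recipCauchy μ Complex.I).re : ℂ) + z + ∫ s : ℝ, nevKernel z s ∂ρ

/-- `ρ` is the Nevanlinna measure of `F_μ`: a finite Borel measure on `ℝ` such that
`F_μ(z) = a + z + ∫ (1 + s z) / (s - z) dρ(s)` for every `z` in the open upper half-plane.
For `Im z > 0` the integrand is bounded and continuous, hence integrable. -/
def IsNevanlinnaMeasure (μ ρ : Measure ℝ) : Prop :=
  IsFiniteMeasure ρ ∧ ∀ z : ℂ, 0 < z.im → recipCauchy μ z = nevFormula μ ρ z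

end NevanlinnaExt

namespace NevanlinnaExt

/-! ### Schwarz and Herglotz formulas on the unit disc. -/

section Representation

open Metric Complex Filter Topology Real

/-! Everything rests on the energy `E(z) = ∫ (1 + s²) / |s - z|² dρ(s)` (`nevEnergy`). For `Im z >
0` the Nevanlinna formula gives `Im F_μ(z) = Im z * (1 + E(z))`, hence `Im H_t(z) = Im z * (1 - (t -
1) E(z))`, so `Ω_t` is the set where `E < 1 / (t - 1)`. By Fatou `E` is lower semicontinuous on all
of `ℂ`, so `E ≤ 1 / (t - 1)` persists on the closure, real points included
(`nevEnergy_le_of_mem_closure`). Finite energy rules out an atom at `z` and makes the kernel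
integrable, so the formula itself defines the extension.

Subtracting the formula at two points leaves `F(z₁) - F(z₂) - (z₁ - z₂) = (z₁ - z₂) ∫ (1 + s²) / ((s
- z₁)(s - z₂)) dρ(s)`. By AM-GM the integral is at most the mean of the two energies, hence at most
`1 / (t - 1)` (`norm_nevFormula_sub_sub_le`). Thus `F` is the identity plus a `1 / (t -
1)`-Lipschitz map, and `1 ± 1 / (t - 1)` are the two constants.

The existence of `ρ` is Herglotz's theorem on the disc, carried to the half-plane by the Cayley
transform; the behaviour of `F_μ` along the imaginary axis shows that the linear coefficient is `1`.
-/

/-- **Schwarz integral formula** on a disc centred at the origin. -/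
theorem circleAverage_herglotzRieszKernel_re {g : ℂ → ℂ} {R : ℝ}
    (hg : DiffContOnCl ℂ g (ball 0 R)) {w : ℂ} (hw : w ∈ ball (0 : ℂ) R) :
    circleAverage (fun ζ ↦ herglotzRieszKernel 0 w ζ • ((g ζ).re : ℂ)) 0 R + (g 0).im * I
      = g w := by
  have hR : 0 < R := pos_of_mem_ball hw
  have h0 : (0 : ℂ) ∈ ball (0 : ℂ) R := mem_ball_self hR
  have hgc : ContinuousOn g (sphere 0 R) :=
    hg.2.mono (sphere_subset_closedBall.trans_eq (closure_ball 0 hR.ne').symm)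
  have hgre : CircleIntegrable (fun ζ ↦ (g ζ).re) 0 R :=
    (continuous_re.comp_continuousOn hgc).circleIntegrable hR.le
  have hgreC : CircleIntegrable (fun ζ ↦ ((g ζ).re : ℂ)) 0 R :=
    (continuous_ofReal.comp_continuousOn
      (continuous_re.comp_continuousOn hgc)).circleIntegrable hR.le
  set h : ℂ → ℂ := fun w ↦ circleAverage (fun ζ ↦ herglotzRieszKernel 0 w ζ • ((g ζ).re : ℂ)) 0 R
    with hh
  have hre : ∀ v ∈ ball (0 : ℂ) R, (h v).re = (g v).re := by
    intro v hv
    have e1 := re_circleAverage_herglotzRieszKernel_smul hgre hv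
    have e2 := hg.circleAverage_re_herglotzRieszKernel_smul hv
    have hci : CircleIntegrable ((re ∘ herglotzRieszKernel 0 v) • g) 0 R := by
      apply ContinuousOn.circleIntegrable hR.le
      apply ContinuousOn.smul _ hgc
      have := continuousOn_herglotzRieszKernel_sphere hv
      rw [abs_of_pos hR] at this
      exact continuous_re.comp_continuousOn this
    have e3 := reCLM.circleAverage_comp_comm hci
    rw [e2] at e3
    rw [hh]
    simp only
    rw [e1, ← reCLM_apply (g v), ← e3]
    congr 1
    ext ζ
    simp
  -- `g - h` is analytic with zero real part, hence constant; its value is read off at `0`, where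
  -- the kernel is `1` and `h 0` is real.
  have han : AnalyticOnNhd ℂ (fun v ↦ g v - h v) (ball 0 R) :=
    (hg.1.analyticOnNhd isOpen_ball).sub
      (analyticOnNhd_circleAverage_herglotzRieszKernel_smul hgreC)
  obtain ⟨c, hc⟩ := han.eq_const_of_re_eq_const (c₀ := 0)
    (fun v hv ↦ by simp [hre v hv]) isOpen_ball
    ((convex_ball _ _).isConnected ⟨0, h0⟩)
  have hker : ∀ ζ ∈ sphere (0 : ℂ) |R|, herglotzRieszKernel 0 0 ζ = 1 := by
    intro ζ hζ
    have : ζ ≠ 0 := by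
      rintro rfl
      simp only [mem_sphere, dist_self] at hζ
      exact (abs_pos.2 hR.ne').ne hζ
    simp [herglotzRieszKernel_def, this]
  have him : (h 0).im = 0 := by
    have e : h 0 = circleAverage (fun ζ ↦ ((g ζ).re : ℂ)) 0 R :=
      circleAverage_congr_sphere fun ζ hζ ↦ by simp [hker ζ hζ]
    have e' := imCLM.circleAverage_comp_comm hgreC
    rw [e, ← imCLM_apply, ← e']
    simp [Function.comp_def, circleAverage_def]
  have e1 := hc w hw
  have e2 := hc 0 h0
  have e3 : g 0 - h 0 = (g 0).im * I := by
    apply Complex.ext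
    · simp [hre 0 h0]
    · simp [him]
  rw [← e3, e2, ← e1]
  ring

/-- Radial averages of a function with positive real part are given by a probability measure on
the unit circle. -/
theorem exists_probabilityMeasure_circleAverage {u : ℂ → ℝ}
    (hu : ContinuousOn u (sphere 0 1)) (hpos : ∀ ζ ∈ sphere (0 : ℂ) 1, 0 ≤ u ζ)
    (hone : circleAverage u 0 1 = 1) :
    ∃ σ : ProbabilityMeasure (sphere (0 : ℂ) 1), ∀ f : ℂ → ℂ, ContinuousOn f (sphere 0 1) →
      ∫ ζ, f ζ ∂(σ : Measure (sphere (0 : ℂ) 1)) =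
        circleAverage (fun ζ ↦ f ζ • (u ζ : ℂ)) 0 1 := by
  have hmem : ∀ θ : ℝ, circleMap 0 1 θ ∈ sphere (0 : ℂ) 1 := fun θ ↦
    circleMap_mem_sphere 0 zero_le_one θ
  let e : ℝ → sphere (0 : ℂ) 1 := fun θ ↦ ⟨circleMap 0 1 θ, hmem θ⟩
  have he : Continuous e := (continuous_circleMap 0 1).subtype_mk _
  have huc : Continuous fun θ ↦ u (circleMap 0 1 θ) :=
    hu.comp_continuous (continuous_circleMap 0 1) hmem
  let d : ℝ → ℝ := fun θ ↦ (2 * π)⁻¹ * u (circleMap 0 1 θ)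
  have hd : Continuous d := continuous_const.mul huc
  have hd0 : ∀ θ, 0 ≤ d θ := fun θ ↦ mul_nonneg (by positivity) (hpos _ (hmem θ))
  let ν : Measure ℝ := (volume.restrict (Set.Ioc 0 (2 * π))).withDensity
    (fun θ ↦ ENNReal.ofReal (d θ))
  have hdi : Integrable d (volume.restrict (Set.Ioc 0 (2 * π))) :=
    (hd.integrableOn_Icc (a := 0) (b := 2 * π)).mono_set Set.Ioc_subset_Icc_self
  have hν : IsProbabilityMeasure ν := by
    constructor
    rw [withDensity_apply _ MeasurableSet.univ, Measure.restrict_univ,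
      ← ofReal_integral_eq_lintegral_ofReal hdi (ae_of_all _ hd0), ← ENNReal.ofReal_one, ← hone,
      circleAverage_def, intervalIntegral.integral_of_le (by positivity), smul_eq_mul,
      ← integral_const_mul]
  refine ⟨⟨ν.map e, Measure.isProbabilityMeasure_map he.aemeasurable⟩, fun f hf ↦ ?_⟩
  have hfc : Continuous fun ζ : sphere (0 : ℂ) 1 ↦ f ζ := hf.domRestrict
  rw [ProbabilityMeasure.coe_mk, integral_map he.aemeasurable hfc.aestronglyMeasurable,
    integral_withDensity_eq_integral_toReal_smul (by fun_prop) (by simp), circleAverage_def,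
    intervalIntegral.integral_of_le (by positivity), ← integral_smul]
  refine integral_congr_ae (ae_of_all _ fun θ ↦ ?_)
  simp only [ENNReal.toReal_ofReal (hd0 θ), d, e]
  simp only [real_smul, smul_eq_mul]
  push_cast
  ring

/-- **Herglotz representation theorem** for functions with nonnegative real part on the unit
disc, normalised at the origin. -/
theorem exists_herglotz_measure {f : ℂ → ℂ} (hf : DifferentiableOn ℂ f (ball 0 1))
    (hpos : ∀ w ∈ ball (0 : ℂ) 1, 0 ≤ (f w).re) (hone : (f 0).re = 1) :
    ∃ σ : ProbabilityMeasure (sphere (0 : ℂ) 1), ∀ w ∈ ball (0 : ℂ) 1,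
      f w = ∫ ζ, herglotzRieszKernel 0 w ζ ∂(σ : Measure (sphere (0 : ℂ) 1)) + (f 0).im * I := by
  -- The dilates `f (r n * w)` are continuous up to the circle; the `+ 2` keeps `r n` strictly
  -- between `0` and `1` already at `n = 0`.
  let r : ℕ → ℝ := fun n ↦ 1 - 1 / ((n : ℝ) + 2)
  have hr0 : ∀ n, 0 < r n := by
    intro n
    have : (1 : ℝ) / ((n : ℝ) + 2) < 1 := by
      rw [div_lt_one (by positivity)]
      have : (0 : ℝ) ≤ n := by positivity
      linarith
    simp only [r]; linarith
  have hr1 : ∀ n, r n < 1 := by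
    intro n
    have : (0 : ℝ) < 1 / ((n : ℝ) + 2) := by positivity
    simp only [r]; linarith
  have hr : Tendsto r atTop (𝓝 1) := by
    have h2 : Tendsto (fun n : ℕ ↦ (n : ℝ) + 2) atTop atTop :=
      tendsto_atTop_add_const_right _ _ tendsto_natCast_atTop_atTop
    have h3 := (tendsto_inv_atTop_zero.comp h2).const_sub 1
    simpa [r, Function.comp_def] using h3
  have hmaps : ∀ n, Set.MapsTo (fun w : ℂ ↦ (r n : ℂ) * w) (closedBall 0 1) (ball 0 1) := by
    intro n w hw
    simp only [mem_closedBall, dist_zero_right, mem_ball, norm_mul, norm_real, norm_eq_abs,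
      abs_of_pos (hr0 n)] at hw ⊢
    nlinarith [hr0 n, hr1 n, norm_nonneg w]
  have hdc : ∀ n, DiffContOnCl ℂ (fun w : ℂ ↦ f (r n * w)) (ball 0 1) := by
    intro n
    apply DifferentiableOn.diffContOnCl
    rw [closure_ball 0 one_ne_zero]
    exact hf.comp (by fun_prop) (hmaps n)
  have hσ : ∀ n, ∃ σ : ProbabilityMeasure (sphere (0 : ℂ) 1), ∀ w ∈ ball (0 : ℂ) 1,
      f (r n * w) =
        ∫ ζ, herglotzRieszKernel 0 w ζ ∂(σ : Measure (sphere (0 : ℂ) 1)) + (f 0).im * I := by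
    intro n
    have hcont : ContinuousOn (fun w : ℂ ↦ f (r n * w)) (sphere 0 1) :=
      (hdc n).2.mono (sphere_subset_closedBall.trans_eq (closure_ball 0 one_ne_zero).symm)
    have hav : circleAverage (fun w : ℂ ↦ (f (r n * w)).re) 0 1 = 1 := by
      have h1 := reCLM.circleAverage_comp_comm (hcont.circleIntegrable zero_le_one)
      have h2 : circleAverage (fun w : ℂ ↦ f (r n * w)) 0 1 = f (r n * 0) :=
        DiffContOnCl.circleAverage (by simpa using hdc n)
      rw [h2] at h1
      simpa [Function.comp_def, hone] using h1
    obtain ⟨σ, hσ⟩ := exists_probabilityMeasure_circleAverage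
      (continuous_re.comp_continuousOn hcont)
      (fun ζ hζ ↦ hpos _ (hmaps n (sphere_subset_closedBall hζ))) hav
    refine ⟨σ, fun w hw ↦ ?_⟩
    have hK := continuousOn_herglotzRieszKernel_sphere hw
    rw [abs_one] at hK
    rw [hσ _ hK, ← circleAverage_herglotzRieszKernel_re (hdc n) hw]
    simp
  choose σ hσ using hσ
  -- Probability measures on the circle form a weakly compact space, so the representing measures
  -- converge along an ultrafilter; for fixed `w` the kernel is a continuous test function.
  let U : Ultrafilter ℕ := Ultrafilter.of atTop
  have hU : (U : Filter ℕ) ≤ atTop := Ultrafilter.of_le _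
  obtain ⟨τ, -, hτ⟩ := isCompact_univ.ultrafilter_le_nhds (U.map σ) (by simp)
  have hτ' : Tendsto σ U (𝓝 τ) := hτ
  refine ⟨τ, fun w hw ↦ ?_⟩
  have hK : Continuous fun ζ : sphere (0 : ℂ) 1 ↦ herglotzRieszKernel 0 w ζ := by
    have hK := continuousOn_herglotzRieszKernel_sphere hw
    rw [abs_one] at hK
    exact hK.domRestrict
  have l1 := ((ProbabilityMeasure.tendsto_iff_forall_integral_rclike_tendsto ℂ).1 hτ'
    (BoundedContinuousFunction.mkOfCompact ⟨_, hK⟩)).add_const ((f 0).im * I)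
  have l2 : Tendsto (fun n ↦ f (r n * w)) U (𝓝 (f w)) := by
    have hc : ContinuousAt f w := (hf.differentiableAt (isOpen_ball.mem_nhds hw)).continuousAt
    have : Tendsto (fun n ↦ (r n : ℂ) * w) U (𝓝 w) := by
      have := (((continuous_ofReal.tendsto 1).comp hr).mul_const w).mono_left hU
      simpa using this
    exact hc.tendsto.comp this
  refine tendsto_nhds_unique l2 (l1.congr fun n ↦ ?_)
  simpa using (hσ n w hw).symm

/-! ### Transfer to the upper half-plane by the Cayley transform. -/

/-- Under the Cayley transform, the Herglotz kernel of the disc becomes the Nevanlinna kernel. -/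
theorem I_mul_herglotzRieszKernel_cayley {z ζ : ℂ} (hz : z + I ≠ 0) (hζ : ‖ζ‖ = 1) (hζ1 : ζ ≠ 1)
    (hne : (z - I) / (z + I) ≠ ζ) :
    I * herglotzRieszKernel 0 ((z - I) / (z + I)) ζ =
      nevKernel z (I * (1 + ζ) / (1 - ζ)).re := by
  have h1 : 1 - ζ ≠ 0 := sub_ne_zero.2 hζ1.symm
  -- The Cayley map sends the circle minus `1` to the real line, because conjugation is inversion on
  -- the circle.
  have hreal : (((I * (1 + ζ) / (1 - ζ)).re : ℝ) : ℂ) = I * (1 + ζ) / (1 - ζ) := by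
    rw [← conj_eq_iff_re]
    have hz0 : ζ ≠ 0 := by
      rintro rfl
      simp at hζ
    have hconj : (starRingEnd ℂ) ζ = ζ⁻¹ := (inv_eq_conj hζ).symm
    have h2 : 1 - ζ⁻¹ ≠ 0 := by
      intro h
      apply hζ1
      rw [sub_eq_zero] at h
      exact (inv_eq_one.1 h.symm)
    have h3 : ζ - 1 ≠ 0 := sub_ne_zero.2 hζ1
    simp only [map_div₀, map_mul, map_add, map_sub, map_one, conj_I, hconj]
    field_simp
    ring
  unfold nevKernel
  rw [hreal, herglotzRieszKernel_def]
  have h4 : ζ - (z - I) / (z + I) ≠ 0 := sub_ne_zero.2 hne.symm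
  have h5 : ζ * (z + I) - (z - I) ≠ 0 := by
    intro h
    apply h4
    field_simp
    rw [h, mul_zero]
  have h6 : I * (1 + ζ) / (1 - ζ) - z ≠ 0 := by
    intro h
    apply h5
    field_simp at h
    linear_combination h
  have h7 : I * (1 + ζ) - (1 - ζ) * z ≠ 0 := by
    intro h
    apply h6
    field_simp
    rw [h, mul_zero]
  have h8 : I * (1 + ζ) - z * (1 - ζ) ≠ 0 := by rwa [mul_comm z]
  simp only [sub_zero]
  field_simp
  have h9 : (1 - ζ + I * (1 + ζ) * z) * (ζ * (z + I) - (z - I)) =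
      I * (ζ * (z + I) + (z - I)) * (I * (1 + ζ) - (1 - ζ) * z) := by
    linear_combination ((1 + ζ) * z * (1 + ζ) - z * (1 - ζ) ^ 2 - (ζ * (z + I) + (z - I)) * (1 + ζ)) * I_sq
  linear_combination -h9

theorem norm_cayley_lt_one {z : ℂ} (hz : 0 < z.im) : ‖(z - I) / (z + I)‖ < 1 := by
  have hzI : z + I ≠ 0 := by
    intro h
    have := congrArg Complex.im h
    simp at this
    linarith
  rw [norm_div, div_lt_one (norm_pos_iff.2 hzI), ← sq_lt_sq₀ (norm_nonneg _) (norm_nonneg _),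
    Complex.sq_norm, Complex.sq_norm, normSq_apply, normSq_apply]
  simp
  nlinarith

theorem im_cayley_symm {w : ℂ} (hw : ‖w‖ < 1) : 0 < (I * (1 + w) / (1 - w)).im := by
  have h1 : 1 - w ≠ 0 := by
    intro h
    rw [← sub_eq_zero.1 h] at hw
    simp at hw
  have h2 : 0 < normSq (1 - w) := normSq_pos.2 h1
  have h3 : normSq w < 1 := by
    rw [← Complex.sq_norm]
    nlinarith [norm_nonneg w]
  rw [div_im, ← sub_div]
  apply div_pos _ h2
  rw [normSq_apply] at h3
  simp
  nlinarith

/-- **Nevanlinna representation theorem** for Pick functions. -/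
theorem exists_nevanlinna_measure {F : ℂ → ℂ} (hF : DifferentiableOn ℂ F {z | 0 < z.im})
    (hpos : ∀ z : ℂ, 0 < z.im → 0 ≤ (F z).im) (hI : 0 < (F I).im) :
    ∃ (ρ : Measure ℝ) (b : ℝ), IsFiniteMeasure ρ ∧
      ∀ z : ℂ, 0 < z.im → F z = (F I).re + b * z + ∫ s, nevKernel z s ∂ρ := by
  let c : ℝ := (F I).im
  have hc : (c : ℂ) ≠ 0 := ofReal_ne_zero.2 hI.ne'
  -- The factor `-I` turns nonnegative imaginary part into nonnegative real part, and dividing by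
  -- `c` gives `Re f(0) = 1`, since `0` is sent to `I`.
  let f : ℂ → ℂ := fun w ↦ -I * F (I * (1 + w) / (1 - w)) / c
  have hfre : ∀ w, (f w).re = (F (I * (1 + w) / (1 - w))).im / c := fun w ↦ by
    simp [f, div_ofReal_re]
  have hfim : ∀ w, (f w).im = -(F (I * (1 + w) / (1 - w))).re / c := fun w ↦ by
    simp [f, div_ofReal_im]
  have hball : ∀ w ∈ ball (0 : ℂ) 1, ‖w‖ < 1 := fun w hw ↦ by simpa using hw
  have hfd : DifferentiableOn ℂ f (ball 0 1) := by
    have h1 : DifferentiableOn ℂ (fun w : ℂ ↦ I * (1 + w) / (1 - w)) (ball 0 1) := by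
      intro w hw
      have h1 : 1 - w ≠ 0 := by
        intro h
        have := hball w hw
        rw [← sub_eq_zero.1 h] at this
        simp at this
      exact DifferentiableAt.differentiableWithinAt (by fun_prop (disch := assumption))
    have h2 : DifferentiableOn ℂ (fun w : ℂ ↦ F (I * (1 + w) / (1 - w))) (ball 0 1) :=
      hF.comp h1 fun w hw ↦ im_cayley_symm (hball w hw)
    exact (h2.const_mul _).div_const _
  obtain ⟨σ, hσ⟩ := exists_herglotz_measure hfd
    (fun w hw ↦ by
      rw [hfre]
      exact div_nonneg (hpos _ (im_cayley_symm (hball w hw))) hI.le)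
    (by rw [hfre]; simp [c, hI.ne'])
  -- The point `1` corresponds to infinity: its mass yields the linear term `b * z`, and the
  -- remaining mass is pushed forward to the line.
  let one : sphere (0 : ℂ) 1 := ⟨1, by simp⟩
  let s : sphere (0 : ℂ) 1 → ℝ := fun ζ ↦ (I * (1 + (ζ : ℂ)) / (1 - ζ)).re
  have hs : Measurable s := by fun_prop
  let m : Measure (sphere (0 : ℂ) 1) := σ
  refine ⟨ENNReal.ofReal c • (m.restrict {one}ᶜ).map s, c * m.real {one}, ?_, fun z hz ↦ ?_⟩
  · exact Measure.smul_finite _ ENNReal.ofReal_ne_top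
  have hzI : z + I ≠ 0 := by
    intro h
    have := congrArg Complex.im h
    simp at this
    linarith
  set w : ℂ := (z - I) / (z + I) with hw
  have hw1 : ‖w‖ < 1 := norm_cayley_lt_one hz
  have hwb : w ∈ ball (0 : ℂ) 1 := by simpa using hw1
  have hwz : I * (1 + w) / (1 - w) = z := by
    have e1 : 1 + w = 2 * z / (z + I) := by
      rw [hw]; field_simp; ring
    have e2 : 1 - w = 2 * I / (z + I) := by
      rw [hw]; field_simp; ring
    rw [e1, e2]
    field_simp
  have hFz : F z = I * c * f w := by
    simp only [f]
    rw [hwz]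
    field_simp
    linear_combination F z * I_sq
  have hf0 : (f 0).im = -(F I).re / c := by rw [hfim]; simp
  have hKc : Continuous fun ζ : sphere (0 : ℂ) 1 ↦ herglotzRieszKernel 0 w ζ := by
    have hK := continuousOn_herglotzRieszKernel_sphere hwb
    rw [abs_one] at hK
    exact hK.domRestrict
  have hKi : Integrable (fun ζ : sphere (0 : ℂ) 1 ↦ herglotzRieszKernel 0 w ζ) m :=
    hKc.integrable_of_hasCompactSupport (HasCompactSupport.of_compactSpace _)
  have hsm : MeasurableSet ({one} : Set (sphere (0 : ℂ) 1)) := measurableSet_singleton _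
  have hsplit : ∫ ζ, herglotzRieszKernel 0 w ζ ∂m = m.real {one} • herglotzRieszKernel 0 w 1 +
      ∫ ζ in {one}ᶜ, herglotzRieszKernel 0 w ζ ∂m := by
    rw [← integral_add_compl hsm hKi, integral_singleton]
  have hone : I * herglotzRieszKernel 0 w 1 = z := by
    rw [← hwz, herglotzRieszKernel_def]
    simp
    ring
  have hker : Measurable (nevKernel z) := by
    unfold nevKernel
    fun_prop
  have hint : ∫ x, nevKernel z x ∂(ENNReal.ofReal c • (m.restrict {one}ᶜ).map s) =
      c * (I * ∫ ζ in {one}ᶜ, herglotzRieszKernel 0 w ζ ∂m) := by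
    rw [integral_smul_measure, ENNReal.toReal_ofReal hI.le,
      integral_map hs.aemeasurable hker.aestronglyMeasurable, ← integral_const_mul, real_smul]
    congr 1
    refine setIntegral_congr_fun hsm.compl fun ζ hζ ↦ ?_
    have hn : ‖(ζ : ℂ)‖ = 1 := by simp
    refine (I_mul_herglotzRieszKernel_cayley hzI hn (fun h ↦ hζ (Subtype.ext h)) ?_).symm
    intro h
    rw [← hw] at h
    rw [h, hn] at hw1
    exact lt_irrefl _ hw1
  rw [hint, hFz, hσ w hwb, hsplit, hf0, real_smul]
  push_cast
  rw [show I * c * (m.real {one} * herglotzRieszKernel 0 w 1 +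
      ∫ ζ in {one}ᶜ, herglotzRieszKernel 0 w ζ ∂m + -(F I).re / c * I) =
      (c / c) * (-(I * I)) * (F I).re + c * m.real {one} * (I * herglotzRieszKernel 0 w 1) +
      c * (I * ∫ ζ in {one}ᶜ, herglotzRieszKernel 0 w ζ ∂m) by ring, hone, I_mul_I, div_self hc]
  ring

/-! ### The Cauchy transform and its asymptotics on the imaginary axis. -/

theorem im_le_norm_sub_ofReal (z : ℂ) (s : ℝ) : |z.im| ≤ ‖z - s‖ := by
  simpa using abs_im_le_norm (z - s)

theorem sub_ofReal_ne_zero {z : ℂ} (hz : 0 < z.im) (s : ℝ) : z - s ≠ 0 := by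
  intro h
  have := congrArg Complex.im h
  simp at this
  exact hz.ne' this

theorem norm_one_div_sub_le {z : ℂ} {δ : ℝ} (hδ : 0 < δ) (hz : δ ≤ z.im) (s : ℝ) :
    ‖1 / (z - (s : ℂ))‖ ≤ 1 / δ := by
  rw [norm_div, norm_one]
  exact one_div_le_one_div_of_le hδ (hz.trans ((le_abs_self _).trans (im_le_norm_sub_ofReal z s)))

theorem integrable_one_div_sub (μ : Measure ℝ) [IsFiniteMeasure μ] {z : ℂ} (hz : 0 < z.im) :
    Integrable (fun s : ℝ ↦ 1 / (z - (s : ℂ))) μ :=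
  Integrable.of_bound (Measurable.aestronglyMeasurable (by fun_prop)) (1 / z.im)
    (ae_of_all _ fun s ↦ norm_one_div_sub_le hz le_rfl s)

theorem cauchyTransform_im_neg (μ : Measure ℝ) [IsProbabilityMeasure μ] {z : ℂ} (hz : 0 < z.im) :
    (cauchyTransform μ z).im < 0 := by
  have hi := integrable_one_div_sub μ hz
  have h1 : (cauchyTransform μ z).im = ∫ s : ℝ, (1 / (z - (s : ℂ))).im ∂μ :=
    (imCLM.integral_comp_comm hi).symm
  have hneg : ∀ s : ℝ, 0 < -(1 / (z - (s : ℂ))).im := fun s ↦ by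
    have := normSq_pos.2 (sub_ofReal_ne_zero hz s)
    have h : (1 / (z - (s : ℂ))).im = -z.im / normSq (z - s) := by simp
    rw [h, ← neg_div, neg_neg]
    positivity
  have h2 : 0 < ∫ s : ℝ, -(1 / (z - (s : ℂ))).im ∂μ := by
    rw [integral_pos_iff_support_of_nonneg (fun s ↦ (hneg s).le) hi.im.neg]
    have : Function.support (fun s : ℝ ↦ -(1 / (z - (s : ℂ))).im) = Set.univ :=
      Set.eq_univ_of_forall fun s ↦ (hneg s).ne'
    rw [this]
    simp
  rw [integral_neg] at h2
  rw [h1]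
  linarith

theorem cauchyTransform_ne_zero (μ : Measure ℝ) [IsProbabilityMeasure μ] {z : ℂ}
    (hz : 0 < z.im) : cauchyTransform μ z ≠ 0 := fun h ↦ by
  have := cauchyTransform_im_neg μ hz
  simp [h] at this

theorem recipCauchy_im_pos (μ : Measure ℝ) [IsProbabilityMeasure μ] {z : ℂ} (hz : 0 < z.im) :
    0 < (recipCauchy μ z).im := by
  have h1 := cauchyTransform_im_neg μ hz
  have h2 := normSq_pos.2 (cauchyTransform_ne_zero μ hz)
  have h3 : (recipCauchy μ z).im = -(cauchyTransform μ z).im / normSq (cauchyTransform μ z) := by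
    simp [recipCauchy]
  rw [h3]
  exact div_pos (by linarith) h2

theorem differentiableOn_cauchyTransform (μ : Measure ℝ) [IsFiniteMeasure μ] :
    DifferentiableOn ℂ (cauchyTransform μ) {z | 0 < z.im} := by
  intro z hz
  have hz : 0 < z.im := hz
  have hδ : 0 < z.im / 2 := by positivity
  have hball : ∀ x ∈ ball z (z.im / 2), z.im / 2 ≤ x.im := by
    intro x hx
    have h1 := abs_im_le_norm (x - z)
    rw [mem_ball, dist_eq_norm] at hx
    have h2 := neg_abs_le (x - z).im
    simp only [sub_im] at h1 h2
    linarith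
  have hpos : ∀ x ∈ ball z (z.im / 2), 0 < x.im := fun x hx ↦ hδ.trans_le (hball x hx)
  refine DifferentiableAt.differentiableWithinAt (HasDerivAt.differentiableAt
    (hasDerivAt_integral_of_dominated_loc_of_deriv_le (μ := μ) (x₀ := z) (s := ball z (z.im / 2))
    (F := fun x (s : ℝ) ↦ 1 / (x - (s : ℂ)))
    (F' := fun x (s : ℝ) ↦ -1 / (x - (s : ℂ)) ^ 2) (bound := fun _ ↦ (1 / (z.im / 2)) ^ 2)
    (ball_mem_nhds z hδ) (Eventually.of_forall fun x ↦ Measurable.aestronglyMeasurable (by fun_prop))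
    (integrable_one_div_sub μ hz) (Measurable.aestronglyMeasurable (by fun_prop)) (ae_of_all _ fun s x hx ↦ ?_)
    (integrable_const _) (ae_of_all _ fun s x hx ↦ ?_)).2)
  · rw [show -1 / (x - (s : ℂ)) ^ 2 = -(1 / (x - (s : ℂ))) ^ 2 by
      rw [div_pow, one_pow, neg_div], norm_neg, norm_pow]
    gcongr
    exact norm_one_div_sub_le hδ (hball x hx) s
  · simpa using ((hasDerivAt_id x).sub_const (s : ℂ)).fun_inv (sub_ofReal_ne_zero (hpos x hx) s)

theorem differentiableOn_recipCauchy (μ : Measure ℝ) [IsProbabilityMeasure μ] :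
    DifferentiableOn ℂ (recipCauchy μ) {z | 0 < z.im} :=
  (differentiableOn_const 1).div (differentiableOn_cauchyTransform μ)
    fun _ hz ↦ cauchyTransform_ne_zero μ hz

/-- Dominated convergence: with `z = iy`, the integrand `z / (z - s)` tends to `1` and has modulus
at most `1`. -/
theorem tendsto_mul_cauchyTransform (μ : Measure ℝ) [IsProbabilityMeasure μ] :
    Tendsto (fun n : ℕ ↦ (((n : ℝ) + 1 : ℝ) * I) * cauchyTransform μ (((n : ℝ) + 1 : ℝ) * I))
      atTop (𝓝 1) := by
  simp only [cauchyTransform, ← integral_const_mul]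
  have e : ∫ _ : ℝ, (1 : ℂ) ∂μ = 1 := by simp
  refine Tendsto.mono_right ?_ (congrArg 𝓝 e).le
  refine tendsto_integral_of_dominated_convergence (fun _ ↦ 1)
    (fun n ↦ Measurable.aestronglyMeasurable (by fun_prop))
    (integrable_const _) (fun n ↦ ae_of_all _ fun s ↦ ?_) (ae_of_all _ fun s ↦ ?_)
  · have hn : (0 : ℝ) < (n : ℝ) + 1 := by positivity
    have h := norm_one_div_sub_le (z := ((n : ℝ) + 1 : ℝ) * I) hn (by simp) s
    rw [norm_mul, norm_mul, norm_I, norm_real, norm_eq_abs, abs_of_pos hn, mul_one]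
    calc _ ≤ ((n : ℝ) + 1) * (1 / ((n : ℝ) + 1)) := by gcongr
      _ = 1 := by field_simp
  · have h1 : Tendsto (fun n : ℕ ↦ (((n : ℝ) + 1 : ℝ) : ℂ)⁻¹) atTop (𝓝 0) := by
      have := tendsto_one_div_add_atTop_nhds_zero_nat (𝕜 := ℂ)
      simpa using this
    have h2 : Tendsto (fun n : ℕ ↦ I / (I - s * (((n : ℝ) + 1 : ℝ) : ℂ)⁻¹)) atTop
        (𝓝 (I / (I - s * 0))) :=
      tendsto_const_nhds.div (tendsto_const_nhds.sub (h1.const_mul _)) (by simp)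
    rw [mul_zero, sub_zero, div_self I_ne_zero] at h2
    refine h2.congr fun n ↦ ?_
    have hn : (((n : ℝ) + 1 : ℝ) : ℂ) ≠ 0 := by
      exact_mod_cast (by positivity : (n : ℝ) + 1 ≠ 0)
    generalize (((n : ℝ) + 1 : ℝ) : ℂ) = y at hn
    rw [show I - s * y⁻¹ = (y * I - s) / y by field_simp]
    rw [div_div_eq_mul_div]
    ring

theorem tendsto_integral_nevKernel_div (ρ : Measure ℝ) [IsFiniteMeasure ρ] :
    Tendsto (fun n : ℕ ↦ (∫ s, nevKernel (((n : ℝ) + 1 : ℝ) * I) s ∂ρ) / (((n : ℝ) + 1 : ℝ) * I))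
      atTop (𝓝 0) := by
  simp only [← integral_div]
  rw [show (0 : ℂ) = ∫ _ : ℝ, (0 : ℂ) ∂ρ by simp]
  -- With `y = n + 1` this is `(s - i/y) / (s - iy)`, of modulus at most `1` because `y ≥ 1`.
  have hkey : ∀ (n : ℕ) (s : ℝ), nevKernel (((n : ℝ) + 1 : ℝ) * I) s / (((n : ℝ) + 1 : ℝ) * I) =
      (-I * (((n : ℝ) + 1 : ℝ) : ℂ)⁻¹ + s) * (1 / (s - ((n : ℝ) + 1 : ℝ) * I)) := by
    intro n s
    have hn : (((n : ℝ) + 1 : ℝ) : ℂ) ≠ 0 := by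
      exact_mod_cast (by positivity : (n : ℝ) + 1 ≠ 0)
    unfold nevKernel
    generalize (((n : ℝ) + 1 : ℝ) : ℂ) = y at hn
    rw [div_right_comm, div_eq_mul_one_div]
    congr 1
    field_simp
    linear_combination I_sq
  have h1 : Tendsto (fun n : ℕ ↦ (((n : ℝ) + 1 : ℝ) : ℂ)⁻¹) atTop (𝓝 0) := by
    have := tendsto_one_div_add_atTop_nhds_zero_nat (𝕜 := ℂ)
    simpa using this
  refine tendsto_integral_of_dominated_convergence (fun _ ↦ 1)
    (fun n ↦ by unfold nevKernel; exact Measurable.aestronglyMeasurable (by fun_prop))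
    (integrable_const _) (fun n ↦ ae_of_all _ fun s ↦ ?_) (ae_of_all _ fun s ↦ ?_)
  · have hn : (1 : ℝ) ≤ (n : ℝ) + 1 := by
      have : (0 : ℝ) ≤ n := by positivity
      linarith
    have hn0 : (0 : ℝ) < (n : ℝ) + 1 := by linarith
    rw [hkey]
    generalize (n : ℝ) + 1 = y at hn hn0
    rw [norm_mul, norm_div, norm_one, mul_one_div]
    apply div_le_one_of_le₀ _ (norm_nonneg _)
    rw [← sq_le_sq₀ (norm_nonneg _) (norm_nonneg _), Complex.sq_norm, Complex.sq_norm,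
      normSq_apply, normSq_apply]
    have hy : y⁻¹ ≤ 1 := inv_le_one_of_one_le₀ hn
    have hy0 : 0 < y⁻¹ := by positivity
    rw [← ofReal_inv]
    simp
    nlinarith
  · simp only [hkey]
    have h2 : Tendsto (fun n : ℕ ↦ (-I * (((n : ℝ) + 1 : ℝ) : ℂ)⁻¹ + s) *
        ((((n : ℝ) + 1 : ℝ) : ℂ)⁻¹ * (1 / (s * (((n : ℝ) + 1 : ℝ) : ℂ)⁻¹ - I)))) atTop
        (𝓝 ((-I * 0 + s) * (0 * (1 / (s * 0 - I))))) :=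
      ((h1.const_mul _).add_const _).mul (h1.mul (tendsto_const_nhds.div
        ((h1.const_mul _).sub_const _) (by simp)))
    simp only [zero_mul, mul_zero] at h2
    refine h2.congr fun n ↦ ?_
    have hn : (((n : ℝ) + 1 : ℝ) : ℂ) ≠ 0 := by
      exact_mod_cast (by positivity : (n : ℝ) + 1 ≠ 0)
    generalize (((n : ℝ) + 1 : ℝ) : ℂ) = y at hn
    rw [show s * y⁻¹ - I = (s - y * I) / y by field_simp]
    congr 1
    rw [one_div_div, ← mul_div_assoc, inv_mul_cancel₀ hn]

theorem exists_isNevanlinnaMeasure (μ : Measure ℝ) [IsProbabilityMeasure μ] :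
    ∃ ρ : Measure ℝ, IsNevanlinnaMeasure μ ρ := by
  obtain ⟨ρ, b, hρ, h⟩ := exists_nevanlinna_measure (differentiableOn_recipCauchy μ)
    (fun z hz ↦ (recipCauchy_im_pos μ hz).le) (recipCauchy_im_pos μ (by simp))
  -- Both sides compute the limit of `F_μ(iy) / (iy)`: the formula gives `b`, and the Cauchy
  -- transform gives `1`.
  have hb : (b : ℂ) = 1 := by
    have l1 := (tendsto_mul_cauchyTransform μ).inv₀ one_ne_zero
    have l2 := tendsto_integral_nevKernel_div ρ
    have h1 : Tendsto (fun n : ℕ ↦ (((n : ℝ) + 1 : ℝ) : ℂ)⁻¹) atTop (𝓝 0) := by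
      have := tendsto_one_div_add_atTop_nhds_zero_nat (𝕜 := ℂ)
      simpa using this
    have l3 := ((h1.const_mul (((recipCauchy μ I).re : ℂ) / I)).add_const (b : ℂ)).add l2
    rw [mul_zero, zero_add, add_zero] at l3
    rw [inv_one] at l1
    refine tendsto_nhds_unique l3 (l1.congr fun n ↦ ?_)
    have hn : (((n : ℝ) + 1 : ℝ) : ℂ) ≠ 0 := by
      exact_mod_cast (by positivity : (n : ℝ) + 1 ≠ 0)
    have hy := h (((n : ℝ) + 1 : ℝ) * I) (by simp; positivity)
    rw [mul_inv, inv_eq_one_div (cauchyTransform μ _)]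
    change _ * recipCauchy μ _ = _
    rw [hy]
    generalize (((n : ℝ) + 1 : ℝ) : ℂ) = y at hn
    have := I_ne_zero
    field_simp
  refine ⟨ρ, hρ, fun z hz ↦ ?_⟩
  rw [h z hz, hb, one_mul, nevFormula]

end Representation

/-! ### The energy and the estimates it controls. -/

section Energy
open Metric Complex Filter Topology ENNReal

/-- The energy `∫ (1 + s²) / |s - z|² dρ(s)`, with value `∞` of the integrand at `s = z`. -/
noncomputable def nevEnergy (ρ : Measure ℝ) (z : ℂ) : ℝ≥0∞ :=
  ∫⁻ s : ℝ, ENNReal.ofReal (1 + s ^ 2) / ENNReal.ofReal (normSq (s - z)) ∂ρ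

/-- Fatou's lemma along a convergent sequence. The value `∞` at `s = z` makes the integrand
continuous in `z` at every point, so limits on the real axis need no separate treatment. -/
theorem isClosed_setOf_nevEnergy_le (ρ : Measure ℝ) (C : ℝ≥0∞) :
    IsClosed {z : ℂ | nevEnergy ρ z ≤ C} := by
  apply IsSeqClosed.isClosed
  intro z w hz hw
  have hlim : ∀ s : ℝ, Tendsto (fun n ↦ ENNReal.ofReal (1 + s ^ 2) /
      ENNReal.ofReal (normSq (s - z n))) atTop
      (𝓝 (ENNReal.ofReal (1 + s ^ 2) / ENNReal.ofReal (normSq (s - w)))) := by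
    intro s
    have h1 : 0 < ENNReal.ofReal (1 + s ^ 2) := ENNReal.ofReal_pos.2 (by positivity)
    apply ENNReal.Tendsto.div tendsto_const_nhds (Or.inl h1.ne') _ (Or.inl ENNReal.ofReal_ne_top)
    exact ENNReal.tendsto_ofReal
      ((continuous_normSq.tendsto _).comp (tendsto_const_nhds.sub hw))
  calc nevEnergy ρ w = ∫⁻ s : ℝ, liminf (fun n ↦ ENNReal.ofReal (1 + s ^ 2) /
      ENNReal.ofReal (normSq (s - z n))) atTop ∂ρ :=
        lintegral_congr fun s ↦ (hlim s).liminf_eq.symm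
    _ ≤ liminf (fun n ↦ nevEnergy ρ (z n)) atTop := by
        apply lintegral_liminf_le
        intro n
        have : Measurable fun s : ℝ ↦ normSq (s - z n) :=
          (continuous_normSq.comp (by fun_prop)).measurable
        fun_prop
    _ ≤ C := by
        refine liminf_le_of_frequently_le' (Frequently.of_forall hz)

theorem measure_singleton_of_nevEnergy_ne_top {ρ : Measure ℝ} {z : ℂ} (h : nevEnergy ρ z ≠ ∞) :
    ρ {s : ℝ | (s : ℂ) = z} = 0 := by
  have hm : Measurable fun s : ℝ ↦ normSq (s - z) :=
    (continuous_normSq.comp (by fun_prop)).measurable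
  have := ae_lt_top (by fun_prop) h
  refine measure_mono_null (fun s hs ↦ ?_) (ae_iff.1 this)
  have hs : (s : ℂ) = z := hs
  have h1 : 0 < ENNReal.ofReal (1 + s ^ 2) := ENNReal.ofReal_pos.2 (by positivity)
  simp [hs, ENNReal.div_zero h1.ne']

/-- Finite energy makes the real energy density integrable. -/
theorem integrable_energy {ρ : Measure ℝ} {z : ℂ} (h : nevEnergy ρ z ≠ ∞) :
    Integrable (fun s : ℝ ↦ (1 + s ^ 2) / normSq (s - z)) ρ ∧
      ∫ s : ℝ, (1 + s ^ 2) / normSq (s - z) ∂ρ = (nevEnergy ρ z).toReal := by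
  have hm : Measurable fun s : ℝ ↦ normSq (s - z) :=
    (continuous_normSq.comp (by fun_prop)).measurable
  have hae : ∀ᵐ s : ℝ ∂ρ, ENNReal.ofReal ((1 + s ^ 2) / normSq (s - z)) =
      ENNReal.ofReal (1 + s ^ 2) / ENNReal.ofReal (normSq (s - z)) := by
    have h0 : ∀ᵐ s : ℝ ∂ρ, (s : ℂ) ≠ z := by
      rw [ae_iff]
      simpa using measure_singleton_of_nevEnergy_ne_top h
    filter_upwards [h0] with s hs
    exact ENNReal.ofReal_div_of_pos (normSq_pos.2 (sub_ne_zero.2 hs))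
  have hnn : ∀ s : ℝ, 0 ≤ (1 + s ^ 2) / normSq (s - z) := fun s ↦
    div_nonneg (by positivity) (normSq_nonneg _)
  have hl : ∫⁻ s : ℝ, ENNReal.ofReal ((1 + s ^ 2) / normSq (s - z)) ∂ρ = nevEnergy ρ z :=
    lintegral_congr_ae hae
  have hmeas : Measurable (fun s : ℝ ↦ (1 + s ^ 2) / normSq (s - z)) := by fun_prop
  refine ⟨⟨hmeas.aestronglyMeasurable, ?_⟩, ?_⟩
  · rw [hasFiniteIntegral_iff_ofReal (ae_of_all _ hnn), hl]
    exact h.lt_top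
  · rw [integral_eq_lintegral_of_nonneg_ae (ae_of_all _ hnn) hmeas.aestronglyMeasurable, hl]

/-- The difference quotient of the Nevanlinna kernel. -/
theorem nevKernel_sub {z₁ z₂ : ℂ} {s : ℝ} (h₁ : (s : ℂ) ≠ z₁) (h₂ : (s : ℂ) ≠ z₂) :
    nevKernel z₁ s - nevKernel z₂ s =
      (z₁ - z₂) * ((1 + (s : ℂ) ^ 2) / ((s - z₁) * (s - z₂))) := by
  have h3 := sub_ne_zero.2 h₁
  have h4 := sub_ne_zero.2 h₂
  unfold nevKernel
  field_simp
  ring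

theorem norm_energy_mul_le (z₁ z₂ : ℂ) (s : ℝ) :
    ‖(1 + (s : ℂ) ^ 2) / ((s - z₁) * (s - z₂))‖ ≤
      ((1 + s ^ 2) / normSq (s - z₁) + (1 + s ^ 2) / normSq (s - z₂)) / 2 := by
  have h : ‖(1 + (s : ℂ) ^ 2)‖ = 1 + s ^ 2 := by
    rw [show (1 + (s : ℂ) ^ 2) = ((1 + s ^ 2 : ℝ) : ℂ) by push_cast; rfl, norm_real,
      Real.norm_of_nonneg (by positivity)]
  rw [norm_div, h, norm_mul, normSq_eq_norm_sq, normSq_eq_norm_sq]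
  generalize ‖(s : ℂ) - z₁‖ = x
  generalize ‖(s : ℂ) - z₂‖ = y
  -- AM-GM with an explicit remainder; it also holds when `x` or `y` is `0`, since then the inverse
  -- is `0`.
  have e : ((1 + s ^ 2) / x ^ 2 + (1 + s ^ 2) / y ^ 2) / 2 - (1 + s ^ 2) / (x * y) =
      (1 + s ^ 2) * (x⁻¹ - y⁻¹) ^ 2 / 2 := by
    simp only [div_eq_mul_inv, mul_inv]
    ring
  have : 0 ≤ (1 + s ^ 2) * (x⁻¹ - y⁻¹) ^ 2 / 2 := by positivity
  linarith

theorem norm_nevKernel_le (z : ℂ) (s : ℝ) (h : (s : ℂ) ≠ z) :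
    ‖nevKernel z s‖ ≤ ‖z‖ + (‖1 + z ^ 2‖ / 2) * (1 + (1 + s ^ 2) / normSq (s - z)) := by
  have h1 := sub_ne_zero.2 h
  have e : nevKernel z s = z + (1 + z ^ 2) * (1 / (s - z)) := by
    unfold nevKernel
    field_simp
    ring
  have h2 : ‖1 / ((s : ℂ) - z)‖ ≤ (1 + (1 + s ^ 2) / normSq (s - z)) / 2 := by
    rw [norm_div, norm_one, normSq_eq_norm_sq]
    have hx : 0 < ‖(s : ℂ) - z‖ := norm_pos_iff.2 h1
    generalize ‖(s : ℂ) - z‖ = x at hx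
    have : 1 / x ^ 2 ≤ (1 + s ^ 2) / x ^ 2 := by
      gcongr
      nlinarith [sq_nonneg s]
    have h3 : 1 / x ^ 2 = (1 / x) ^ 2 := by rw [div_pow, one_pow]
    nlinarith [sq_nonneg (1 / x - 1)]
  rw [e]
  calc _ ≤ ‖z‖ + ‖1 + z ^ 2‖ * ‖1 / ((s : ℂ) - z)‖ := by
        rw [← norm_mul]; exact norm_add_le _ _
    _ ≤ ‖z‖ + ‖1 + z ^ 2‖ * ((1 + (1 + s ^ 2) / normSq (s - z)) / 2) := by gcongr
    _ = _ := by ring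

theorem measurable_nevKernel (z : ℂ) : Measurable (nevKernel z) := by
  unfold nevKernel
  fun_prop

theorem integrable_nevKernel {ρ : Measure ℝ} [IsFiniteMeasure ρ] {z : ℂ}
    (h : nevEnergy ρ z ≠ ∞) : Integrable (nevKernel z) ρ := by
  have hi := (integrable_energy h).1
  refine Integrable.mono' ((integrable_const ‖z‖).add
    (((integrable_const (1 : ℝ)).add hi).const_mul (‖1 + z ^ 2‖ / 2)))
    (measurable_nevKernel z).aestronglyMeasurable ?_
  have h0 : ∀ᵐ s : ℝ ∂ρ, (s : ℂ) ≠ z := by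
    rw [ae_iff]
    simpa using measure_singleton_of_nevEnergy_ne_top h
  filter_upwards [h0] with s hs
  exact norm_nevKernel_le z s hs

/-- The Nevanlinna formula is a perturbation of the identity on sets of bounded energy. -/
theorem norm_nevFormula_sub_sub_le {μ ρ : Measure ℝ} [IsFiniteMeasure ρ] {C : ℝ} (hC : 0 ≤ C)
    {z₁ z₂ : ℂ} (h₁ : nevEnergy ρ z₁ ≤ ENNReal.ofReal C) (h₂ : nevEnergy ρ z₂ ≤ ENNReal.ofReal C) :
    ‖nevFormula μ ρ z₁ - nevFormula μ ρ z₂ - (z₁ - z₂)‖ ≤ C * ‖z₁ - z₂‖ := by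
  have t₁ : nevEnergy ρ z₁ ≠ ∞ := ne_top_of_le_ne_top ENNReal.ofReal_ne_top h₁
  have t₂ : nevEnergy ρ z₂ ≠ ∞ := ne_top_of_le_ne_top ENNReal.ofReal_ne_top h₂
  obtain ⟨i₁, e₁⟩ := integrable_energy t₁
  obtain ⟨i₂, e₂⟩ := integrable_energy t₂
  have c₁ := ENNReal.toReal_le_of_le_ofReal hC h₁
  have c₂ := ENNReal.toReal_le_of_le_ofReal hC h₂
  have hne : ∀ {z : ℂ}, nevEnergy ρ z ≠ ∞ → ∀ᵐ s : ℝ ∂ρ, (s : ℂ) ≠ z := fun h ↦ by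
    rw [ae_iff]
    simpa using measure_singleton_of_nevEnergy_ne_top h
  have e : nevFormula μ ρ z₁ - nevFormula μ ρ z₂ - (z₁ - z₂) =
      (z₁ - z₂) * ∫ s : ℝ, (1 + (s : ℂ) ^ 2) / ((s - z₁) * (s - z₂)) ∂ρ := by
    rw [← integral_const_mul]
    have : ∫ s : ℝ, (z₁ - z₂) * ((1 + (s : ℂ) ^ 2) / ((s - z₁) * (s - z₂))) ∂ρ =
        ∫ s : ℝ, nevKernel z₁ s - nevKernel z₂ s ∂ρ := by
      apply integral_congr_ae
      filter_upwards [hne t₁, hne t₂] with s h₁ h₂ using (nevKernel_sub h₁ h₂).symm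
    rw [this, integral_sub (integrable_nevKernel t₁) (integrable_nevKernel t₂)]
    unfold nevFormula
    ring
  rw [e, norm_mul, mul_comm]
  gcongr
  calc _ ≤ ∫ s : ℝ, ((1 + s ^ 2) / normSq (s - z₁) + (1 + s ^ 2) / normSq (s - z₂)) / 2 ∂ρ :=
        norm_integral_le_of_norm_le ((i₁.add i₂).div_const 2)
          (ae_of_all _ fun s ↦ norm_energy_mul_le z₁ z₂ s)
    _ = ((nevEnergy ρ z₁).toReal + (nevEnergy ρ z₂).toReal) / 2 := by
        rw [integral_div, integral_add i₁ i₂, e₁, e₂]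
    _ ≤ C := by linarith

theorem nevKernel_im {z : ℂ} (s : ℝ) :
    (nevKernel z s).im = z.im * ((1 + s ^ 2) / normSq (s - z)) := by
  rw [nevKernel, div_im]
  simp
  ring

/-- The energy is finite on the open upper half-plane. -/
theorem nevEnergy_ne_top {ρ : Measure ℝ} [IsFiniteMeasure ρ] {z : ℂ} (hz : 0 < z.im) :
    nevEnergy ρ z ≠ ∞ := by
  -- Comes from `s² ≤ 2 (s - Re z)² + 2 (Re z)²`.
  have hb : ∀ s : ℝ, ENNReal.ofReal (1 + s ^ 2) / ENNReal.ofReal (normSq (s - z)) ≤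
      ENNReal.ofReal ((1 + 2 * z.re ^ 2) / z.im ^ 2 + 2) := by
    intro s
    have hn : normSq (s - z) = (s - z.re) ^ 2 + z.im ^ 2 := by
      rw [normSq_apply]; simp; ring
    have hp : 0 < normSq (s - z) := by rw [hn]; positivity
    rw [← ENNReal.ofReal_div_of_pos hp]
    apply ENNReal.ofReal_le_ofReal
    rw [div_le_iff₀ hp, hn, add_mul, div_mul_eq_mul_div, mul_add, add_div,
      mul_div_cancel_right₀ _ (by positivity)]
    have : 0 ≤ (1 + 2 * z.re ^ 2) * (s - z.re) ^ 2 / z.im ^ 2 := by positivity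
    nlinarith [sq_nonneg (s - 2 * z.re), sq_nonneg z.im]
  refine ne_top_of_le_ne_top ?_ (lintegral_mono hb)
  rw [lintegral_const]
  exact ENNReal.mul_ne_top ENNReal.ofReal_ne_top (measure_ne_top _ _)

theorem nevFormula_im {μ ρ : Measure ℝ} [IsFiniteMeasure ρ] {z : ℂ} (hz : 0 < z.im) :
    (nevFormula μ ρ z).im = z.im * (1 + (nevEnergy ρ z).toReal) := by
  have h := nevEnergy_ne_top (ρ := ρ) hz
  have e : (∫ s, nevKernel z s ∂ρ).im = ∫ s, (nevKernel z s).im ∂ρ :=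
    (imCLM.integral_comp_comm (integrable_nevKernel h)).symm
  simp only [nevKernel_im, integral_const_mul, (integrable_energy h).2] at e
  rw [nevFormula, add_im, e]
  simp
  ring

/-- On `Ω_t` the sign of `Im H_t = Im z * (1 - (t - 1) E)` forces the bound, and closedness of the
sublevel set extends it to the closure. -/
theorem nevEnergy_le_of_mem_closure {μ ρ : Measure ℝ} {t : ℝ} (ht : 1 < t)
    (hρ : IsNevanlinnaMeasure μ ρ) {z : ℂ} (hz : z ∈ closure (omegaSet μ t)) :
    nevEnergy ρ z ≤ ENNReal.ofReal (1 / (t - 1)) := by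
  have := hρ.1
  refine closure_minimal (fun w hw ↦ ?_) (isClosed_setOf_nevEnergy_le ρ _) hz
  obtain ⟨h0, h1⟩ := hw
  rw [subordH, hρ.2 w h0] at h1
  have h2 : ((t : ℂ) * w - ((t : ℂ) - 1) * nevFormula μ ρ w).im =
      t * w.im - (t - 1) * (nevFormula μ ρ w).im := by simp
  rw [h2, nevFormula_im h0] at h1
  apply ENNReal.le_ofReal_iff_toReal_le (nevEnergy_ne_top h0) (by
    have : 0 < t - 1 := by linarith
    positivity) |>.2
  rw [le_div_iff₀ (by linarith)]
  by_contra hlt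
  push Not at hlt
  nlinarith


theorem norm_nevFormula_sub_bounds {μ ρ : Measure ℝ} {t : ℝ} (ht : 1 < t)
    (hρ : IsNevanlinnaMeasure μ ρ) {z₁ z₂ : ℂ} (h₁ : z₁ ∈ closure (omegaSet μ t))
    (h₂ : z₂ ∈ closure (omegaSet μ t)) :
    ‖nevFormula μ ρ z₁ - nevFormula μ ρ z₂‖ ≤ t / (t - 1) * ‖z₁ - z₂‖ ∧
      (t - 2) / (t - 1) * ‖z₁ - z₂‖ ≤ ‖nevFormula μ ρ z₁ - nevFormula μ ρ z₂‖ := by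
  have := hρ.1
  have ht' : 0 < t - 1 := by linarith
  have h := norm_nevFormula_sub_sub_le (μ := μ) (by positivity)
    (nevEnergy_le_of_mem_closure ht hρ h₁) (nevEnergy_le_of_mem_closure ht hρ h₂)
  have e₁ : t / (t - 1) = 1 + 1 / (t - 1) := by field_simp; ring
  have e₂ : (t - 2) / (t - 1) = 1 - 1 / (t - 1) := by field_simp; ring
  have n₁ := norm_sub_norm_le (nevFormula μ ρ z₁ - nevFormula μ ρ z₂) (z₁ - z₂)
  have n₂ := norm_sub_norm_le (z₁ - z₂) (nevFormula μ ρ z₁ - nevFormula μ ρ z₂)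
  rw [norm_sub_rev (z₁ - z₂)] at n₂
  rw [e₁, e₂]
  constructor <;> linarith

theorem continuousOn_nevFormula {μ ρ : Measure ℝ} {t : ℝ} (ht : 1 < t)
    (hρ : IsNevanlinnaMeasure μ ρ) :
    ContinuousOn (nevFormula μ ρ) (closure (omegaSet μ t)) := by
  have : LipschitzOnWith (t / (t - 1)).toNNReal (nevFormula μ ρ) (closure (omegaSet μ t)) := by
    apply LipschitzOnWith.of_dist_le_mul
    intro x hx y hy
    rw [Real.coe_toNNReal _ (div_nonneg (by linarith) (by linarith)), dist_eq_norm, dist_eq_norm]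
    exact (norm_nevFormula_sub_bounds ht hρ hx hy).1
  exact this.continuousOn

end Energy

end NevanlinnaExt

/-! ### The main theorem. -/

theorem proposition3p5 (μ : MeasureTheory.Measure ℝ) [MeasureTheory.IsProbabilityMeasure μ]
    (t : ℝ) (ht : 1 < t) :
    ∃ Φ : ℂ → ℂ,
      -- `Φ` is a continuous extension of `F_μ` to the closure of `Ω_t`
      ContinuousOn Φ (closure (NevanlinnaExt.omegaSet μ t)) ∧
      (∀ z ∈ closure (NevanlinnaExt.omegaSet μ t), 0 < z.im →
        Φ z = NevanlinnaExt.recipCauchy μ z) ∧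
      -- Lipschitz bound
      (∀ z₁ ∈ closure (NevanlinnaExt.omegaSet μ t),
        ∀ z₂ ∈ closure (NevanlinnaExt.omegaSet μ t),
          ‖Φ z₁ - Φ z₂‖ ≤ t / (t - 1) * ‖z₁ - z₂‖) ∧
      -- the Nevanlinna measure exists, and its integral formula gives `Φ` on the closure
      (∃ ρ : MeasureTheory.Measure ℝ, NevanlinnaExt.IsNevanlinnaMeasure μ ρ) ∧
      (∀ ρ : MeasureTheory.Measure ℝ, NevanlinnaExt.IsNevanlinnaMeasure μ ρ →
        ∀ z ∈ closure (NevanlinnaExt.omegaSet μ t),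
          ρ {s : ℝ | (s : ℂ) = z} = 0 ∧
          MeasureTheory.Integrable (NevanlinnaExt.nevKernel z) ρ ∧
          Φ z = NevanlinnaExt.nevFormula μ ρ z) ∧
      -- lower bound and injectivity
      (2 < t →
        (∀ z₁ ∈ closure (NevanlinnaExt.omegaSet μ t),
          ∀ z₂ ∈ closure (NevanlinnaExt.omegaSet μ t),
            (t - 2) / (t - 1) * ‖z₁ - z₂‖ ≤ ‖Φ z₁ - Φ z₂‖) ∧
        Set.InjOn Φ (closure (NevanlinnaExt.omegaSet μ t))) := by
  obtain ⟨ρ₀, hρ₀⟩ := NevanlinnaExt.exists_isNevanlinnaMeasure μ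
  refine ⟨NevanlinnaExt.nevFormula μ ρ₀, NevanlinnaExt.continuousOn_nevFormula ht hρ₀,
    fun z _ hz ↦ (hρ₀.2 z hz).symm, fun z₁ h₁ z₂ h₂ ↦ (NevanlinnaExt.norm_nevFormula_sub_bounds ht hρ₀ h₁ h₂).1,
    ⟨ρ₀, hρ₀⟩, fun ρ hρ z hz ↦ ?_, fun ht2 ↦ ⟨fun z₁ h₁ z₂ h₂ ↦
      (NevanlinnaExt.norm_nevFormula_sub_bounds ht hρ₀ h₁ h₂).2, fun z₁ h₁ z₂ h₂ he ↦ ?_⟩⟩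
  · have := hρ.1
    have hfin : NevanlinnaExt.nevEnergy ρ z ≠ ⊤ := ne_top_of_le_ne_top ENNReal.ofReal_ne_top
      (NevanlinnaExt.nevEnergy_le_of_mem_closure ht hρ hz)
    refine ⟨NevanlinnaExt.measure_singleton_of_nevEnergy_ne_top hfin,
      NevanlinnaExt.integrable_nevKernel hfin, ?_⟩
    -- Uniqueness of the measure is not needed: both formulas equal `F_μ` on `Ω_t` and are
    -- continuous on its closure.
    refine Set.EqOn.of_subset_closure (s := NevanlinnaExt.omegaSet μ t) (fun w hw ↦ ?_)
      (NevanlinnaExt.continuousOn_nevFormula ht hρ₀) (NevanlinnaExt.continuousOn_nevFormula ht hρ) subset_closure subset_rfl hz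
    rw [← hρ₀.2 w hw.1, ← hρ.2 w hw.1]
  · have h := (NevanlinnaExt.norm_nevFormula_sub_bounds ht hρ₀ h₁ h₂).2
    rw [he, sub_self, norm_zero] at h
    have hc : 0 < (t - 2) / (t - 1) := div_pos (by linarith) (by linarith)
    have hn : ‖z₁ - z₂‖ ≤ 0 := nonpos_of_mul_nonpos_right h hc
    exact sub_eq_zero.1 (norm_le_zero_iff.1 hn)
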